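/- There is an absolute constant $C>0$ such that the following holds. Let $X=(X_1,\ldots,X_n)$ be a $\{0,1\}^n$-valued random vector and let $A_1,\ldots,A_n$ be symmetric $d\times d$ real matrices. For $\Lambda\subseteq[n]$ and $\tau\in\{0,1\}^\Lambda$ let $\Psi^{\Lambda,\tau}$ be the $n\times n$ matrix with entries $$\Psi^{\Lambda,\tau}(i,j)=\mathbb P(X_j=1\mid X_i=1,\ X_\ell=\tau_\ell\ \forall \ell\in\Lambda)-\mathbb P(X_j=1\mid X_i=0,\ X_\ell=\tau_\ell\ \forall \ell\in\Lambda)$$ if both conditioning events have positive probability, and $\Psi^{\Lambda,\tau}(i,j)=0$ otherwise. Assume that $X$ is two-sided $\ell_\infty$-independent with parameter $D$, i.e. for all $\Lambda\subseteq[n]$ and $\tau\in\{0,1\}^\Lambda$, $$\|\Psi^{\Lambda,\tau}\|_{\ell_\infty\to\ell_\infty}=\max_{1\le i\le n}\sum_{j=1}^n|\Psi^{\Lambda,\tau}(i,j)|\le D.$$ Let $Z=\sum_{i=1}^n X_iA_i$, $\sigma^2=\big\|\mathbb E\sum_{i=1}^n X_iA_i^2\big\|$ and $R=\max_{i\le n}\|A_i\|$,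 where $\|\cdot\|$ is the $\ell_2\to\ell_2$ operator norm. Then for all $t>0$, $$\mathbb P(\|Z-\mathbb E Z\|\ge t)\le 2d\exp\Big(-\frac{1}{CD^2}\min\Big(\frac{t^2}{\sigma^2},\frac tR\Big)\Big).$$ In the degenerate cases $D=0$, $\sigma^2=0$ or $R=0$, where a denominator vanishes, this is to be read as $\mathbb P(\|Z-\mathbb EZ\|\ge t)=0$. -/

import Mathlib

open MeasureTheory ProbabilityTheory
open scoped Matrix.Norms.L2Operator

noncomputable section

/-- The event `{x ∈ {0,1}ⁿ : x_ℓ = σ_ℓ for all ℓ ∈ Λ}`. -/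
def pinEvent {n : ℕ} (Λ : Finset (Fin n)) (σ : Λ → Fin 2) : Set (Fin n → Fin 2) :=
  {x | ∀ ℓ : Λ, x ℓ = σ ℓ}

open Classical in
/-- The influence matrix `Ψ_μ^{Λ,σ}` of a measure `μ` on `{0,1}ⁿ`: its `(i,j)` entry is
`P(X_j = 1 | X_i = 1, X_Λ = σ) - P(X_j = 1 | X_i = 0, X_Λ = σ)` if both conditioning events
have positive probability, and `0` otherwise. -/
def influenceMatrix {n : ℕ} (μ : Measure (Fin n → Fin 2)) (Λ : Finset (Fin n))
    (σ : Λ → Fin 2) : Matrix (Fin n) (Fin n) ℝ :=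
  Matrix.of fun i j =>
    if 0 < μ ({x | x i = 1} ∩ pinEvent Λ σ) ∧ 0 < μ ({x | x i = 0} ∩ pinEvent Λ σ) then
      (μ[|{x | x i = 1} ∩ pinEvent Λ σ]).real {x | x j = 1}
        - (μ[|{x | x i = 0} ∩ pinEvent Λ σ]).real {x | x j = 1}
    else 0

/-- The operator norm `ℓ_∞ → ℓ_∞` of a square matrix, i.e. its maximal absolute row sum
(`0` for the empty matrix). -/
def linftyNorm {n : ℕ} (M : Matrix (Fin n) (Fin n) ℝ) : ℝ :=
  ⨆ i, ∑ j, |M i j|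

/-- Two-sided `ℓ_∞`-independence with parameter `D` of a measure on `{0,1}ⁿ`. -/
def TwoSidedLinftyIndep {n : ℕ} (μ : Measure (Fin n → Fin 2)) (D : ℝ) : Prop :=
  ∀ (Λ : Finset (Fin n)) (σ : Λ → Fin 2), linftyNorm (influenceMatrix μ Λ σ) ≤ D

/-- The matrix `∑ i, x_i A_i` for `x ∈ {0,1}ⁿ`. -/
def matrixSum {n d : ℕ} (A : Fin n → Matrix (Fin d) (Fin d) ℝ) (x : Fin n → Fin 2) :
    Matrix (Fin d) (Fin d) ℝ :=
  ∑ i, ((x i : ℕ) : ℝ) • A i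

/-- `σ² = ‖E ∑ i, X_i A_i²‖`, with the `ℓ₂ → ℓ₂` operator norm. -/
def varianceProxy {n d : ℕ} {Ω : Type*} [MeasurableSpace Ω] (P : Measure Ω)
    (X : Ω → Fin n → Fin 2) (A : Fin n → Matrix (Fin d) (Fin d) ℝ) : ℝ :=
  ‖∫ ω, matrixSum (fun i => A i ^ 2) (X ω) ∂P‖

/-- `R = max_i ‖A_i‖`, with the `ℓ₂ → ℓ₂` operator norm (`0` for the empty family). -/
def maxNorm {n d : ℕ} (A : Fin n → Matrix (Fin d) (Fin d) ℝ) : ℝ :=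
  ⨆ i, ‖A i‖

/-- The deviation event `{‖Z - E Z‖ ≥ t}` for `Z = ∑ i, X_i A_i`. -/
def deviationEvent {n d : ℕ} {Ω : Type*} [MeasurableSpace Ω] (P : Measure Ω)
    (X : Ω → Fin n → Fin 2) (A : Fin n → Matrix (Fin d) (Fin d) ℝ) (t : ℝ) : Set Ω :=
  {ω | t ≤ ‖matrixSum A (X ω) - ∫ ω', matrixSum A (X ω') ∂P‖}

end

/-! ### Trace inequalities and spectral bounds for real symmetric matrices. -/

section MatrixAnalysis

open Matrix NormedSpace Filter Topology
open scoped MatrixOrder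

variable {m : Type*} [Fintype m] [DecidableEq m]

set_option linter.unusedSectionVars false

/-! ### The Golden–Thompson inequality for real symmetric matrices -/

/-! This is the matrix Laplace transform method, with the coordinates revealed one at a time in an
order averaged over all choices. With `Λ` revealed and `p_j` the current conditional means, follow
the potential `θ ∑ p_j A_j + φ ∑_{j ∉ Λ} p_j A_j²`. Revealing `X_i = b` moves each `p_j` by `(b -
p_i) Ψ i j` (`condMean_slice_sub`) and removes `b A_i²` from the second sum. The increment thus has
a mean-zero part and a drift `-φ p_i A_i²`.

Golden–Thompson (`trace_exp_add_le`) splits the increment off the trace exponential. By `exp Y ≤ 1 +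
Y + Y²` and a matrix Cauchy–Schwarz inequality, its second-order cost is mainly `θ² D p_i (1 - p_i)
∑_j |Ψ i j| A_j²` up to a constant. No single `i` need have its cost paid by its own drift, but the
average over `i` does: `p_i (1 - p_i) Ψ i j` is a covariance, hence symmetric, so row sums at most
`D` also bound the variance-weighted column sums by `D p_j`. Hence `φ = 16 θ² D²` suffices
(`sum_exp_potentialIncrement_le`).

Induction (`sum_trace_exp_subcube_le`) bounds the centred trace moment generating function by `d
exp(φ σ²)`. Markov's inequality for `A` and `-A`, with `θ` optimized, finishes. This needs `D ≥ 1`;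
for `D < 1` the vector is almost surely constant. -/

lemma trace_mul_transpose_self_nonneg (X : Matrix m m ℝ) : 0 ≤ (X * Xᵀ).trace := by
  rw [← conjTranspose_eq_transpose_of_trivial]
  exact (posSemidef_self_mul_conjTranspose X).trace_nonneg

lemma trace_mul_le_half_add (X Y : Matrix m m ℝ) :
    (X * Y).trace ≤ ((X * Xᵀ).trace + (Yᵀ * Y).trace) / 2 := by
  have h := trace_mul_transpose_self_nonneg (X - Yᵀ)
  have e : (Yᵀ * Xᵀ).trace = (X * Y).trace := by
    rw [← transpose_mul, trace_transpose]
  simp only [transpose_sub, transpose_transpose, sub_mul, mul_sub, trace_sub, e] at h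
  linarith

lemma trace_mul_pow_comm (X Y : Matrix m m ℝ) (k : ℕ) :
    ((X * Y) ^ k).trace = ((Y * X) ^ k).trace := by
  cases k with
  | zero => simp
  | succ k =>
    have h : (X * Y) ^ (k + 1) = X * ((Y * X) ^ k * Y) := by
      have : SemiconjBy X (Y * X) (X * Y) := by simp [SemiconjBy, mul_assoc]
      have h := (this.pow_right k).eq
      rw [pow_succ, ← mul_assoc X, h, mul_assoc]
    rw [h, trace_mul_comm, mul_assoc, ← pow_succ]

/-- Simultaneous induction for the two trace inequalities behind Golden–Thompson. -/
lemma trace_pow_two_pow_aux (k : ℕ) :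
    (∀ P Q : Matrix m m ℝ, Pᵀ = P → Qᵀ = Q →
      ((P * Q) ^ 2 ^ k).trace ≤ (P ^ 2 ^ k * Q ^ 2 ^ k).trace) ∧
    (∀ X : Matrix m m ℝ, (X ^ 2 ^ (k + 1)).trace ≤ ((X * Xᵀ) ^ 2 ^ k).trace) := by
  induction k with
  | zero =>
    refine ⟨fun P Q _ _ => by simp, fun X => ?_⟩
    have h := trace_mul_le_half_add X X
    rw [trace_mul_comm Xᵀ X] at h
    simp only [zero_add, pow_one, pow_zero, pow_two]
    linarith
  | succ k ih =>
    obtain ⟨hG, hF⟩ := ih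
    -- The two claims feed each other: the first applies the second to `P * Q` and then itself to
    -- `P²`, `Q²`; the second applies itself to `X²` and then the first to `Xᵀ X` and `X Xᵀ`.
    refine ⟨fun P Q hP hQ => ?_, fun X => ?_⟩
    · calc ((P * Q) ^ 2 ^ (k + 1)).trace ≤ ((P * Q * (P * Q)ᵀ) ^ 2 ^ k).trace := hF _
        _ = ((P ^ 2 * Q ^ 2) ^ 2 ^ k).trace := by
          rw [transpose_mul, hP, hQ, ← mul_assoc, trace_mul_pow_comm]
          simp only [pow_two, mul_assoc]
        _ ≤ ((P ^ 2) ^ 2 ^ k * (Q ^ 2) ^ 2 ^ k).trace :=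
          hG _ _ (by rw [transpose_pow, hP]) (by rw [transpose_pow, hQ])
        _ = _ := by rw [← pow_mul, ← pow_mul, pow_succ' 2 k]
    · calc (X ^ 2 ^ (k + 1 + 1)).trace = ((X * X) ^ 2 ^ (k + 1)).trace := by
            rw [← pow_two, ← pow_mul, ← pow_succ']
        _ ≤ ((X * X * (X * X)ᵀ) ^ 2 ^ k).trace := hF _
        _ = (((Xᵀ * X) * (X * Xᵀ)) ^ 2 ^ k).trace := by
          rw [transpose_mul, mul_assoc, ← mul_assoc X Xᵀ, ← mul_assoc X, trace_mul_pow_comm,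
            ← mul_assoc Xᵀ]
        _ ≤ ((Xᵀ * X) ^ 2 ^ k * (X * Xᵀ) ^ 2 ^ k).trace :=
          hG _ _ (by simp [transpose_mul]) (by simp [transpose_mul])
        _ ≤ _ := by
          refine (trace_mul_le_half_add _ _).trans_eq ?_
          simp only [transpose_pow, transpose_mul, transpose_transpose, ← pow_two, ← pow_mul,
            ← pow_succ]
          rw [trace_mul_pow_comm Xᵀ X]
          ring

lemma trace_mul_pow_two_pow_le (k : ℕ) {P Q : Matrix m m ℝ} (hP : Pᵀ = P) (hQ : Qᵀ = Q) :
    ((P * Q) ^ 2 ^ k).trace ≤ (P ^ 2 ^ k * Q ^ 2 ^ k).trace :=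
  (trace_pow_two_pow_aux k).1 P Q hP hQ

/-- Telescoping: replace one factor `X` by `Y` at a time. -/
lemma norm_pow_sub_pow_le {𝔸 : Type*} [NormedRing 𝔸] {X Y : 𝔸} {M : ℝ}
    (hX : ‖X‖ ≤ M) (hY : ‖Y‖ ≤ M) (n : ℕ) :
    ‖X ^ (n + 1) - Y ^ (n + 1)‖ ≤ (n + 1) * M ^ n * ‖X - Y‖ := by
  have hM : 0 ≤ M := (norm_nonneg X).trans hX
  induction n with
  | zero => simp
  | succ n ih =>
    have e : X ^ (n + 1 + 1) - Y ^ (n + 1 + 1)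
        = (X ^ (n + 1) - Y ^ (n + 1)) * X + Y ^ (n + 1) * (X - Y) := by
      rw [pow_succ X, pow_succ Y]; noncomm_ring
    have hYn : ‖Y ^ (n + 1)‖ ≤ M ^ (n + 1) :=
      (norm_pow_le' _ n.succ_pos).trans (pow_le_pow_left₀ (norm_nonneg _) hY _)
    calc _ ≤ ‖X ^ (n + 1) - Y ^ (n + 1)‖ * ‖X‖ + ‖Y ^ (n + 1)‖ * ‖X - Y‖ := by
          rw [e]; exact (norm_add_le _ _).trans (add_le_add (norm_mul_le _ _) (norm_mul_le _ _))
      _ ≤ ((n + 1) * M ^ n * ‖X - Y‖) * M + M ^ (n + 1) * ‖X - Y‖ := by gcongr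
      _ = _ := by push_cast; ring

lemma norm_exp_le_exp_norm {𝔸 : Type*} [NormedRing 𝔸] [NormedAlgebra ℝ 𝔸] [CompleteSpace 𝔸]
    [NormOneClass 𝔸] (x : 𝔸) : ‖exp x‖ ≤ Real.exp ‖x‖ := by
  rw [exp_eq_tsum ℝ, Real.exp_eq_exp_ℝ]
  refine tsum_of_norm_bounded (expSeries_div_hasSum_exp ‖x‖) fun n => ?_
  rw [norm_smul, norm_inv, Real.norm_natCast, div_eq_inv_mul]
  gcongr
  exact norm_pow_le x n

/-- The Lie product formula. -/
lemma tendsto_exp_mul_exp_pow {𝔸 : Type*} [NormedRing 𝔸] [NormedAlgebra ℝ 𝔸] [CompleteSpace 𝔸]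
    [NormOneClass 𝔸] (A B : 𝔸) :
    Tendsto (fun n : ℕ => (exp ((1 / (n + 1 : ℝ)) • A) * exp ((1 / (n + 1 : ℝ)) • B)) ^ (n + 1))
      atTop (𝓝 (exp (A + B))) := by
  -- The two curves agree to first order, so at `s = 1/(n+1)` they differ by `o(1/n)`; telescoping
  -- the power loses only a factor of order `n`.
  have hd : HasDerivAt (fun s : ℝ => exp (s • A) * exp (s • B) - exp (s • (A + B))) 0 0 := by
    have h := ((hasDerivAt_exp_smul_const (𝕂 := ℝ) A 0).mul
      (hasDerivAt_exp_smul_const (𝕂 := ℝ) B 0)).sub (hasDerivAt_exp_smul_const (𝕂 := ℝ) (A + B) 0)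
    exact h.congr_deriv (by simp)
  have hs := hd.tendsto_slope_zero_right
  have ht : Tendsto (fun n : ℕ => 1 / (n + 1 : ℝ)) atTop (𝓝[>] 0) :=
    tendsto_nhdsWithin_iff.2 ⟨tendsto_one_div_add_atTop_nhds_zero_nat,
      Eventually.of_forall fun n => by simp only [Set.mem_Ioi]; positivity⟩
  have hl := ((hs.comp ht).norm.const_mul (Real.exp (‖A‖ + ‖B‖)))
  rw [norm_zero, mul_zero] at hl
  rw [tendsto_iff_norm_sub_tendsto_zero]
  refine squeeze_zero (fun _ => norm_nonneg _) (fun n => ?_) hl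
  have hn : (0 : ℝ) < n + 1 := by positivity
  set s : ℝ := 1 / (n + 1 : ℝ) with hsdef
  have hs0 : 0 < s := by positivity
  have hns : (n + 1 : ℝ) * s = 1 := mul_one_div_cancel hn.ne'
  have hY : exp (A + B) = exp (s • (A + B)) ^ (n + 1) := by
    let _ : NormedAlgebra ℚ 𝔸 := .restrictScalars ℚ ℝ 𝔸
    rw [← NormedSpace.exp_nsmul, ← Nat.cast_smul_eq_nsmul ℝ, smul_smul]
    push_cast
    rw [hns, one_smul]
  have b1 : ‖exp (s • A) * exp (s • B)‖ ≤ Real.exp (s * (‖A‖ + ‖B‖)) := by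
    refine (norm_mul_le _ _).trans ?_
    rw [mul_add, Real.exp_add]
    gcongr
    · refine (norm_exp_le_exp_norm _).trans_eq ?_
      rw [norm_smul, Real.norm_of_nonneg hs0.le]
    · refine (norm_exp_le_exp_norm _).trans_eq ?_
      rw [norm_smul, Real.norm_of_nonneg hs0.le]
  have b2 : ‖exp (s • (A + B))‖ ≤ Real.exp (s * (‖A‖ + ‖B‖)) := by
    refine (norm_exp_le_exp_norm _).trans (Real.exp_le_exp.2 ?_)
    rw [norm_smul, Real.norm_of_nonneg hs0.le]
    gcongr
    exact norm_add_le A B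
  have hb := norm_pow_sub_pow_le b1 b2 n
  rw [← hY] at hb
  refine hb.trans ?_
  simp only [Function.comp, zero_add, zero_smul, exp_zero, mul_one, sub_self, sub_zero]
  rw [norm_smul, norm_inv, Real.norm_of_nonneg hs0.le, ← Real.exp_nat_mul,
    show s⁻¹ = (n + 1 : ℝ) by rw [hsdef, one_div, inv_inv], mul_comm (n + 1 : ℝ), mul_assoc]
  gcongr
  have h0 : 0 ≤ ‖A‖ + ‖B‖ := by positivity
  nlinarith

/-- The **Golden–Thompson inequality**. -/
lemma trace_exp_add_le {A B : Matrix m m ℝ} (hA : Aᵀ = A) (hB : Bᵀ = B) :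
    (exp (A + B)).trace ≤ (exp A * exp B).trace := by
  rcases isEmpty_or_nonempty m with hm | hm
  · simp [trace]
  -- Along `n = 2^k - 1` the exponent `n + 1` is a power of two, as the trace inequality requires.
  have hlim := (tendsto_exp_mul_exp_pow A B).comp
    (tendsto_atTop_mono (fun k => Nat.le_pred_of_lt (Nat.lt_two_pow_self)) tendsto_id :
      Tendsto (fun k : ℕ => 2 ^ k - 1) atTop atTop)
  have hc : Continuous (fun X : Matrix m m ℝ => X.trace) := Continuous.matrix_trace continuous_id
  refine le_of_tendsto ((hc.tendsto _).comp hlim) (Eventually.of_forall fun k => ?_)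
  have h1 : 2 ^ k - 1 + 1 = 2 ^ k := Nat.sub_add_cancel Nat.one_le_two_pow
  simp only [Function.comp]
  rw [h1]
  have e : ∀ C : Matrix m m ℝ, exp ((1 / (((2 ^ k - 1 : ℕ) : ℝ) + 1)) • C) ^ 2 ^ k = exp C := by
    intro C
    rw [← Matrix.exp_nsmul, ← Nat.cast_smul_eq_nsmul ℝ, smul_smul]
    have : (((2 ^ k - 1 : ℕ) : ℝ) + 1) = ((2 ^ k : ℕ) : ℝ) := by exact_mod_cast h1
    rw [this, mul_one_div_cancel (by positivity), one_smul]
  refine (trace_mul_pow_two_pow_le k ?_ ?_).trans_eq (by rw [e, e])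
  · rw [← Matrix.exp_transpose, transpose_smul, hA]
  · rw [← Matrix.exp_transpose, transpose_smul, hB]

/-! ### Spectral bounds -/

lemma exists_orthogonal_diagonal {Y : Matrix m m ℝ} (hY : Yᵀ = Y) :
    ∃ (U : Matrix m m ℝ) (l : m → ℝ), Uᵀ * U = 1 ∧ U * Uᵀ = 1 ∧ Y = U * diagonal l * Uᵀ ∧
      ‖Y‖ = ‖l‖ := by
  have hH : Y.IsHermitian := by rwa [IsHermitian, conjTranspose_eq_transpose_of_trivial]
  have hs := hH.spectral_theorem
  rw [Unitary.conjStarAlgAut_apply] at hs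
  refine ⟨hH.eigenvectorUnitary, hH.eigenvalues, ?_, ?_, hs, ?_⟩
  · exact Unitary.coe_star_mul_self hH.eigenvectorUnitary
  · exact Unitary.coe_mul_star_self hH.eigenvectorUnitary
  · conv_lhs => rw [hs]
    rw [← Unitary.coe_star, CStarRing.norm_mul_coe_unitary, CStarRing.norm_coe_unitary_mul, l2_opNorm_diagonal]
    rfl

lemma exp_orthogonal_diagonal {U : Matrix m m ℝ} (l : m → ℝ) (h2 : U * Uᵀ = 1) :
    exp (U * diagonal l * Uᵀ) = U * diagonal (fun i => Real.exp (l i)) * Uᵀ := by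
  have hi : U⁻¹ = Uᵀ := inv_eq_right_inv h2
  rw [← hi, exp_conj _ _ (IsUnit.of_mul_eq_one _ h2), exp_diagonal]
  congr 3
  funext i
  rw [Pi.coe_exp, Real.exp_eq_exp_ℝ]

lemma trace_orthogonal_diagonal {U : Matrix m m ℝ} (l : m → ℝ) (h1 : Uᵀ * U = 1) :
    (U * diagonal l * Uᵀ).trace = ∑ i, l i := by
  rw [mul_assoc, trace_mul_comm, mul_assoc, h1, mul_one, trace_diagonal]

lemma trace_exp_le {Y : Matrix m m ℝ} (hY : Yᵀ = Y) :
    (exp Y).trace ≤ Fintype.card m * Real.exp ‖Y‖ := by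
  obtain ⟨U, l, h1, h2, rfl, hn⟩ := exists_orthogonal_diagonal hY
  rw [exp_orthogonal_diagonal l h2, trace_orthogonal_diagonal _ h1, hn]
  refine (Finset.sum_le_card_nsmul _ _ (Real.exp ‖l‖) fun i _ => ?_).trans_eq (by simp)
  exact Real.exp_le_exp.2 ((le_abs_self _).trans (norm_le_pi_norm l i))

/-- Some eigenvalue has modulus at least `t`; its sign decides which trace already contains a large
enough term. -/
lemma exp_le_trace_exp_add {Y : Matrix m m ℝ} (hY : Yᵀ = Y) {t θ : ℝ} (ht : 0 < t)
    (hθ : 0 ≤ θ) (h : t ≤ ‖Y‖) :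
    Real.exp (θ * t) ≤ (exp (θ • Y)).trace + (exp (θ • -Y)).trace := by
  obtain ⟨U, l, h1, h2, rfl, hn⟩ := exists_orthogonal_diagonal hY
  have e : ∀ c : ℝ, (exp (c • (U * diagonal l * Uᵀ))).trace = ∑ i, Real.exp (c * l i) := by
    intro c
    have : c • (U * diagonal l * Uᵀ) = U * diagonal (c • l) * Uᵀ := by
      rw [diagonal_smul]; simp
    rw [this, exp_orthogonal_diagonal _ h2, trace_orthogonal_diagonal _ h1]; rfl
  rw [smul_neg, ← neg_smul, e, e]
  rw [hn] at h
  obtain ⟨i, hi⟩ : ∃ i, t ≤ |l i| := by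
    by_contra! hc
    exact absurd h (not_le.2 ((pi_norm_lt_iff ht).2 hc))
  have s1 := Finset.single_le_sum (f := fun i => Real.exp (θ * l i))
    (fun j _ => (Real.exp_pos _).le) (Finset.mem_univ i)
  have s2 := Finset.single_le_sum (f := fun i => Real.exp (-θ * l i))
    (fun j _ => (Real.exp_pos _).le) (Finset.mem_univ i)
  have p1 := Real.exp_pos (θ * l i)
  have p2 := Real.exp_pos (-θ * l i)
  rcases le_abs'.1 hi with h' | h'
  · have := Real.exp_le_exp.2 (show θ * t ≤ -θ * l i by nlinarith)
    linarith
  · have := Real.exp_le_exp.2 (show θ * t ≤ θ * l i by nlinarith)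
    linarith

/-- Diagonalization reduces this to `e^x ≤ 1 + x + x²` for `|x| ≤ 1`. -/
lemma exp_le_one_add_add_sq {Y : Matrix m m ℝ} (hY : Yᵀ = Y) (h : ‖Y‖ ≤ 1) :
    exp Y ≤ 1 + Y + Y ^ 2 := by
  obtain ⟨U, l, h1, h2, rfl, hn⟩ := exists_orthogonal_diagonal hY
  rw [exp_orthogonal_diagonal l h2, Matrix.le_iff]
  have e : 1 + U * diagonal l * Uᵀ + (U * diagonal l * Uᵀ) ^ 2
      - U * diagonal (fun i => Real.exp (l i)) * Uᵀ
      = U * diagonal (fun i => 1 + l i + l i ^ 2 - Real.exp (l i)) * Uᵀ := by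
    have e1 : (U * diagonal l * Uᵀ) ^ 2 = U * diagonal (fun i => l i ^ 2) * Uᵀ := by
      rw [pow_two, show U * diagonal l * Uᵀ * (U * diagonal l * Uᵀ)
        = U * diagonal l * (Uᵀ * U) * diagonal l * Uᵀ by simp only [mul_assoc], h1, mul_one,
        mul_assoc U, diagonal_mul_diagonal]
      simp only [pow_two]
    have e2 : diagonal (fun i => 1 + l i + l i ^ 2 - Real.exp (l i))
        = 1 + diagonal l + diagonal (fun i => l i ^ 2) - diagonal (fun i => Real.exp (l i)) := by
      rw [← diagonal_one, diagonal_add, diagonal_add, diagonal_sub]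
    rw [e1, e2]
    simp only [mul_add, add_mul, mul_sub, sub_mul, mul_one, h2]
  rw [e, ← conjTranspose_eq_transpose_of_trivial]
  refine PosSemidef.mul_mul_conjTranspose_same (PosSemidef.diagonal fun i => ?_) U
  have hl : |l i| ≤ 1 := (norm_le_pi_norm l i).trans (hn ▸ h)
  have := Real.abs_exp_sub_one_sub_id_le hl
  have := (abs_le.1 this).2
  simp only [Pi.zero_apply]
  linarith

lemma trace_mul_nonneg {P Q : Matrix m m ℝ} (hP : 0 ≤ P) (hQ : 0 ≤ Q) : 0 ≤ (P * Q).trace := by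
  obtain ⟨B, rfl⟩ := CStarAlgebra.nonneg_iff_eq_star_mul_self.1 hP
  rw [mul_assoc, trace_mul_comm, star_eq_conjTranspose]
  exact ((nonneg_iff_posSemidef.1 hQ).mul_mul_conjTranspose_same B).trace_nonneg

lemma exp_nonneg_of_symm {Y : Matrix m m ℝ} (hY : Yᵀ = Y) : 0 ≤ exp Y := by
  obtain ⟨U, l, h1, h2, rfl, hn⟩ := exists_orthogonal_diagonal hY
  rw [exp_orthogonal_diagonal l h2, nonneg_iff_posSemidef,
    ← conjTranspose_eq_transpose_of_trivial]
  exact PosSemidef.mul_mul_conjTranspose_same (PosSemidef.diagonal fun i => (Real.exp_pos _).le) U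

lemma sq_nonneg_of_symm {Y : Matrix m m ℝ} (hY : Yᵀ = Y) : 0 ≤ Y ^ 2 := by
  rw [nonneg_iff_posSemidef, pow_two]
  nth_rw 1 [← hY]
  rw [← conjTranspose_eq_transpose_of_trivial]
  exact posSemidef_conjTranspose_mul_self Y

lemma sq_le_norm_sq {Y : Matrix m m ℝ} (hY : Yᵀ = Y) {R : ℝ} (h : ‖Y‖ ≤ R) :
    Y ^ 2 ≤ (R ^ 2) • (1 : Matrix m m ℝ) := by
  obtain ⟨U, l, h1, h2, rfl, hn⟩ := exists_orthogonal_diagonal hY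
  have e : (R ^ 2) • (1 : Matrix m m ℝ) - (U * diagonal l * Uᵀ) ^ 2
      = U * diagonal (fun i => R ^ 2 - l i ^ 2) * Uᵀ := by
    have e1 : (U * diagonal l * Uᵀ) ^ 2 = U * diagonal (fun i => l i ^ 2) * Uᵀ := by
      rw [pow_two, show U * diagonal l * Uᵀ * (U * diagonal l * Uᵀ)
        = U * diagonal l * (Uᵀ * U) * diagonal l * Uᵀ by simp only [mul_assoc], h1, mul_one,
        mul_assoc U, diagonal_mul_diagonal]
      simp only [pow_two]
    have e2 : diagonal (fun i => R ^ 2 - l i ^ 2)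
        = (R ^ 2) • (1 : Matrix m m ℝ) - diagonal (fun i => l i ^ 2) := by
      rw [smul_one_eq_diagonal, diagonal_sub]
    rw [e1, e2]
    simp only [mul_sub, sub_mul, mul_smul_comm, smul_mul_assoc, mul_one, h2]
  rw [Matrix.le_iff, e, ← conjTranspose_eq_transpose_of_trivial]
  refine PosSemidef.mul_mul_conjTranspose_same (PosSemidef.diagonal fun i => ?_) U
  have hl : |l i| ≤ R := (norm_le_pi_norm l i).trans (hn ▸ h)
  simp only [Pi.zero_apply, sub_nonneg]
  exact sq_le_sq' (by linarith [neg_abs_le (l i)]) ((le_abs_self _).trans hl)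

lemma conj_mono {P Q B : Matrix m m ℝ} (hB : Bᵀ = B) (h : P ≤ Q) : B * P * B ≤ B * Q * B := by
  have := (Matrix.le_iff.1 h).mul_mul_conjTranspose_same B
  rw [conjTranspose_eq_transpose_of_trivial, hB] at this
  rw [Matrix.le_iff]
  convert this using 1
  noncomm_ring

lemma smul_mono_of_nonneg {P Q : Matrix m m ℝ} {c : ℝ} (hc : 0 ≤ c) (h : P ≤ Q) :
    c • P ≤ c • Q := by
  rw [Matrix.le_iff, ← smul_sub]
  exact (Matrix.le_iff.1 h).smul hc

lemma symm_add_sq_le {P Q : Matrix m m ℝ} (hP : Pᵀ = P) (hQ : Qᵀ = Q) :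
    (P + Q) ^ 2 ≤ (2 : ℝ) • P ^ 2 + (2 : ℝ) • Q ^ 2 := by
  have h := sq_nonneg_of_symm (Y := P - Q) (by rw [transpose_sub, hP, hQ])
  rw [← sub_nonneg]
  convert h using 1
  rw [two_smul, two_smul]
  noncomm_ring

/-- A Cauchy–Schwarz inequality for linear combinations of symmetric matrices. -/
lemma sum_smul_sq_le {ι : Type*} (s : Finset ι) (c : ι → ℝ) (M : ι → Matrix m m ℝ)
    (hM : ∀ i ∈ s, (M i)ᵀ = M i) {D : ℝ} (hD : ∑ i ∈ s, |c i| ≤ D) :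
    (∑ i ∈ s, c i • M i) ^ 2 ≤ D • ∑ i ∈ s, |c i| • M i ^ 2 := by
  set T := ∑ i ∈ s, c i • M i with hT
  set Q := ∑ i ∈ s, |c i| • M i ^ 2 with hQ
  set K := ∑ i ∈ s, |c i| with hK
  have hTs : Tᵀ = T := by
    rw [hT, transpose_sum]
    exact Finset.sum_congr rfl fun i hi => by rw [transpose_smul, hM i hi]
  have hQ0 : 0 ≤ Q := Finset.sum_nonneg fun i hi => by
    simpa using smul_mono_of_nonneg (abs_nonneg (c i)) (sq_nonneg_of_symm (hM i hi))
  have hK0 : 0 ≤ K := Finset.sum_nonneg fun i _ => abs_nonneg _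
  have hKD : K • Q ≤ D • Q := by
    rw [← sub_nonneg, ← sub_smul]
    simpa using smul_mono_of_nonneg (sub_nonneg.2 hD) hQ0
  refine le_trans ?_ hKD
  rcases hK0.eq_or_lt with h0 | hpos
  · have hc : ∀ i ∈ s, c i = 0 := fun i hi => abs_eq_zero.1
      ((Finset.sum_eq_zero_iff_of_nonneg fun i _ => abs_nonneg (c i)).1 h0.symm i hi)
    have : T = 0 := Finset.sum_eq_zero fun i hi => by rw [hc i hi, zero_smul]
    rw [this, ← h0]; simp
  -- A weighted variance: `T / K` is the `|c i|/K`-mean of the `sign (c i) • M i`. The sum expands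
  -- to `K (K Q - T²)`.
  have key : 0 ≤ ∑ i ∈ s, |c i| • (K • (SignType.sign (c i) : ℝ) • M i - T) ^ 2 :=
    Finset.sum_nonneg fun i hi => by
      simpa using smul_mono_of_nonneg (abs_nonneg (c i)) (sq_nonneg_of_symm
        (Y := K • (SignType.sign (c i) : ℝ) • M i - T)
        (by rw [transpose_sub, transpose_smul, transpose_smul, hM i hi, hTs]))
  have e : ∀ i ∈ s, |c i| • (K • (SignType.sign (c i) : ℝ) • M i - T) ^ 2
      = (K ^ 2) • (|c i| • M i ^ 2) - K • ((c i • M i) * T + T * (c i • M i))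
        + |c i| • T ^ 2 := by
    intro i _
    have h1 : |c i| * (SignType.sign (c i) : ℝ) = c i := abs_mul_sign _
    have h2 : |c i| * ((SignType.sign (c i) : ℝ) * (SignType.sign (c i) : ℝ)) = |c i| := by
      rw [← mul_assoc, h1, mul_comm, sign_mul_self]
    generalize (SignType.sign (c i) : ℝ) = g at h1 h2
    rw [pow_two (_ - T), mul_sub, sub_mul, sub_mul]
    simp only [smul_mul_assoc, mul_smul_comm, smul_smul, smul_sub, smul_add, ← pow_two]
    rw [smul_pow, smul_smul,
      show |c i| * (K * g) ^ 2 = K ^ 2 * |c i| by linear_combination K ^ 2 * h2,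
      show |c i| * (K * g) = K * c i by linear_combination K * h1]
    abel
  rw [Finset.sum_congr rfl e, Finset.sum_add_distrib, Finset.sum_sub_distrib, ← Finset.smul_sum,
    ← Finset.smul_sum, ← Finset.sum_smul, Finset.sum_add_distrib, ← Finset.sum_mul,
    ← Finset.mul_sum, ← hT, ← hQ, ← hK] at key
  have e2 : (K ^ 2) • Q - K • (T * T + T * T) + K • T ^ 2 = K • (K • Q - T ^ 2) := by
    rw [pow_two T, pow_two K, smul_sub, smul_add, smul_smul]
    abel
  rw [e2] at key
  have := smul_mono_of_nonneg (inv_nonneg.2 hK0) key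
  rw [smul_zero, smul_smul, inv_mul_cancel₀ hpos.ne', one_smul] at this
  exact sub_nonneg.1 this

end MatrixAnalysis

/-! ### One revealing step: size and averaged exponential of the increment. -/

section RevealStep

open Matrix NormedSpace
open scoped MatrixOrder

variable {m : Type*} [Fintype m] [DecidableEq m]

lemma l2_opNorm_one_le : ‖(1 : Matrix m m ℝ)‖ ≤ 1 := by
  rw [← diagonal_one, l2_opNorm_diagonal]
  exact (pi_norm_le_iff_of_nonneg zero_le_one).2 fun i => by simp

lemma norm_smul_one_add_smul_le {A : Matrix m m ℝ} {R θ φ : ℝ} (hR : ‖A‖ ≤ R)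
    (hθ : 0 ≤ θ) (hφ : 0 ≤ φ) (h : φ * R ≤ θ) :
    ‖θ • (1 : Matrix m m ℝ) + φ • A‖ ≤ 2 * θ := by
  refine (norm_add_le _ _).trans ?_
  rw [norm_smul, norm_smul, Real.norm_of_nonneg hθ, Real.norm_of_nonneg hφ]
  have h1 := mul_le_mul_of_nonneg_left (l2_opNorm_one_le (m := m)) hθ
  have h2 := mul_le_mul_of_nonneg_left hR hφ
  linarith

lemma norm_smul_add_smul_sq_le {A : Matrix m m ℝ} {R θ φ : ℝ} (hR : ‖A‖ ≤ R)
    (hθ : 0 ≤ θ) (hφ : 0 ≤ φ) (h : φ * R ≤ θ) :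
    ‖θ • A + φ • A ^ 2‖ ≤ 2 * θ * R := by
  have e : θ • A + φ • A ^ 2 = (θ • (1 : Matrix m m ℝ) + φ • A) * A := by
    rw [add_mul, smul_mul_assoc, smul_mul_assoc, one_mul, pow_two]
  rw [e]
  exact (norm_mul_le _ _).trans
    (mul_le_mul (norm_smul_one_add_smul_le hR hθ hφ h) hR (norm_nonneg _) (by positivity))

/-- The square equals `A (θ + φ A)² A`, and the middle factor is at most `4 θ²`. -/
lemma sq_smul_add_smul_sq_le {A : Matrix m m ℝ} (hA : Aᵀ = A) {R θ φ : ℝ} (hR : ‖A‖ ≤ R)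
    (hθ : 0 ≤ θ) (hφ : 0 ≤ φ) (h : φ * R ≤ θ) :
    (θ • A + φ • A ^ 2) ^ 2 ≤ (4 * θ ^ 2) • A ^ 2 := by
  have h1 := conj_mono hA (sq_le_norm_sq (Y := θ • (1 : Matrix m m ℝ) + φ • A)
    (by simp [hA]) (norm_smul_one_add_smul_le hR hθ hφ h))
  have e1 : A * (θ • (1 : Matrix m m ℝ) + φ • A) ^ 2 * A = (θ • A + φ • A ^ 2) ^ 2 := by
    have c : A * (θ • (1 : Matrix m m ℝ) + φ • A) = θ • A + φ • A ^ 2 := by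
      simp [mul_add, pow_two]
    have c' : (θ • (1 : Matrix m m ℝ) + φ • A) * A = θ • A + φ • A ^ 2 := by
      simp [add_mul, pow_two]
    rw [pow_two, ← mul_assoc, mul_assoc, c, c', ← pow_two]
  rw [e1] at h1
  refine h1.trans_eq ?_
  rw [mul_smul_comm, mul_one, smul_mul_assoc, ← pow_two]
  congr 1
  ring

lemma pow_four_le {A : Matrix m m ℝ} (hA : Aᵀ = A) {R : ℝ} (hR : ‖A‖ ≤ R) :
    (A ^ 2) ^ 2 ≤ R ^ 2 • A ^ 2 := by
  have h := conj_mono hA (sq_le_norm_sq hA hR)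
  rwa [mul_smul_comm, mul_one, smul_mul_assoc, ← pow_two,
    show A * A ^ 2 * A = (A ^ 2) ^ 2 by noncomm_ring] at h

variable {ι : Type*}

/-- The change of the potential when coordinate `i` is revealed to have the value `b`. -/
noncomputable def potentialIncrement (S : Finset ι) (A : ι → Matrix m m ℝ) (p : ι → ℝ)
    (Ψ : ι → ι → ℝ) (θ φ : ℝ) (i : ι) (b : ℝ) : Matrix m m ℝ :=
  (b - p i) • ∑ j ∈ S, Ψ i j • (θ • A j + φ • A j ^ 2) - (φ * b) • A i ^ 2

variable {S : Finset ι} {A : ι → Matrix m m ℝ} {p : ι → ℝ} {Ψ : ι → ι → ℝ} {D R θ φ : ℝ}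

lemma sum_smul_symm (hA : ∀ i, (A i)ᵀ = A i) (c : ι → ℝ) :
    (∑ j ∈ S, c j • (θ • A j + φ • A j ^ 2))ᵀ = ∑ j ∈ S, c j • (θ • A j + φ • A j ^ 2) := by
  rw [transpose_sum]
  exact Finset.sum_congr rfl fun j _ => by simp [hA]

lemma potentialIncrement_symm (hA : ∀ i, (A i)ᵀ = A i) (i : ι) (b : ℝ) :
    (potentialIncrement S A p Ψ θ φ i b)ᵀ = potentialIncrement S A p Ψ θ φ i b := by
  rw [potentialIncrement, transpose_sub, transpose_smul, transpose_smul, sum_smul_symm hA,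
    transpose_pow, hA]

/-- Needed to apply `exp_le_one_add_add_sq`. With `x = D θ R ≤ 1/16` the norm is at most `2x +
16x²`. -/
lemma norm_potentialIncrement_le (hR : ∀ i, ‖A i‖ ≤ R) (hθ : 0 ≤ θ)
    (hD : 1 ≤ D) (hφ : φ = 16 * θ ^ 2 * D ^ 2) (hθR : 16 * D ^ 2 * R * θ ≤ 1) {i : ι}
    (hrow : ∑ j ∈ S, |Ψ i j| ≤ D) {b : ℝ} (hb : |b - p i| ≤ 1) (hb0 : 0 ≤ b) (hb1 : b ≤ 1) :
    ‖potentialIncrement S A p Ψ θ φ i b‖ ≤ 1 := by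
  have hR0 : 0 ≤ R := (norm_nonneg _).trans (hR i)
  have hφ0 : 0 ≤ φ := by rw [hφ]; positivity
  have hφR : φ * R ≤ θ := by
    rw [hφ]; nlinarith
  have h1 : ‖∑ j ∈ S, Ψ i j • (θ • A j + φ • A j ^ 2)‖ ≤ D * (2 * θ * R) := by
    refine (norm_sum_le_of_le S (f := fun j => Ψ i j • (θ • A j + φ • A j ^ 2))
      (n := fun j => |Ψ i j| * (2 * θ * R)) fun j _ => ?_).trans ?_
    · rw [norm_smul, Real.norm_eq_abs]
      exact mul_le_mul_of_nonneg_left (norm_smul_add_smul_sq_le (hR j) hθ hφ0 hφR) (abs_nonneg _)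
    · rw [← Finset.sum_mul]
      exact mul_le_mul_of_nonneg_right hrow (by positivity)
  have h2 : ‖A i ^ 2‖ ≤ R ^ 2 :=
    (norm_pow_le' _ two_pos).trans (pow_le_pow_left₀ (norm_nonneg _) (hR i) 2)
  rw [potentialIncrement]
  refine (norm_sub_le _ _).trans ?_
  rw [norm_smul, norm_smul, Real.norm_eq_abs, Real.norm_of_nonneg (by positivity)]
  have h3 : |b - p i| * ‖∑ j ∈ S, Ψ i j • (θ • A j + φ • A j ^ 2)‖ ≤ 1 * (D * (2 * θ * R)) :=
    mul_le_mul hb h1 (norm_nonneg _) zero_le_one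
  have h4 : φ * b * ‖A i ^ 2‖ ≤ (φ * 1) * R ^ 2 := by gcongr
  have hx : 16 * (D * θ * R) ≤ 1 := by
    have : 0 ≤ (D - 1) * (D * R * θ) :=
      mul_nonneg (by linarith) (by positivity)
    nlinarith
  have hx0 : 0 ≤ D * θ * R := by positivity
  have h5 : φ * 1 * R ^ 2 = 16 * (D * θ * R) ^ 2 := by rw [hφ]; ring
  nlinarith

lemma sq_potentialIncrement_le (hA : ∀ i, (A i)ᵀ = A i) (hR : ∀ i, ‖A i‖ ≤ R) (hθ : 0 ≤ θ)
    (hφ0 : 0 ≤ φ) (hφR : φ * R ≤ θ) (hD : 0 ≤ D) {i : ι} (hrow : ∑ j ∈ S, |Ψ i j| ≤ D) (b : ℝ) :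
    potentialIncrement S A p Ψ θ φ i b ^ 2 ≤
      (8 * θ ^ 2 * D * (b - p i) ^ 2) • (∑ j ∈ S, |Ψ i j| • A j ^ 2)
        + (2 * φ ^ 2 * R ^ 2 * b ^ 2) • A i ^ 2 := by
  set T := ∑ j ∈ S, Ψ i j • (θ • A j + φ • A j ^ 2) with hT
  have h1 : T ^ 2 ≤ (4 * θ ^ 2 * D) • ∑ j ∈ S, |Ψ i j| • A j ^ 2 := by
    refine (sum_smul_sq_le S (Ψ i) _ (fun j _ => by simp [hA]) hrow).trans ?_
    rw [show 4 * θ ^ 2 * D = D * (4 * θ ^ 2) by ring, mul_smul D]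
    refine smul_mono_of_nonneg hD ?_
    rw [Finset.smul_sum]
    refine Finset.sum_le_sum fun j _ => ?_
    rw [smul_comm]
    exact smul_mono_of_nonneg (abs_nonneg _) (sq_smul_add_smul_sq_le (hA j) (hR j) hθ hφ0 hφR)
  have h2 := symm_add_sq_le (P := (b - p i) • T) (Q := (-(φ * b)) • A i ^ 2)
    (by rw [transpose_smul, hT, sum_smul_symm hA]) (by simp [hA])
  rw [neg_smul, ← sub_eq_add_neg] at h2
  refine h2.trans (add_le_add ?_ ?_)
  · rw [smul_pow, smul_smul]
    refine (smul_mono_of_nonneg (by positivity) h1).trans_eq ?_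
    rw [smul_smul]; congr 1; ring
  · rw [neg_sq, smul_pow, smul_smul]
    refine (smul_mono_of_nonneg (by positivity) (pow_four_le (hA i) (hR i))).trans_eq ?_
    rw [smul_smul]; congr 1; ring

/-- Averaged over the coordinate to be revealed, the exponentiated increment of the potential has
mean at most one. -/
lemma sum_exp_potentialIncrement_le (hA : ∀ i, (A i)ᵀ = A i) (hR : ∀ i, ‖A i‖ ≤ R)
    (hθ : 0 ≤ θ) (hD : 1 ≤ D) (hφ : φ = 16 * θ ^ 2 * D ^ 2) (hθR : 16 * D ^ 2 * R * θ ≤ 1)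
    (hp0 : ∀ i, 0 ≤ p i) (hp1 : ∀ i, p i ≤ 1)
    (hsymm : ∀ i j, p i * (1 - p i) * Ψ i j = p j * (1 - p j) * Ψ j i)
    (hrow : ∀ i, ∑ j ∈ S, |Ψ i j| ≤ D) :
    ∑ i ∈ S, (p i • exp (potentialIncrement S A p Ψ θ φ i 1)
      + (1 - p i) • exp (potentialIncrement S A p Ψ θ φ i 0)) ≤ (S.card : ℝ) • 1 := by
  rcases S.eq_empty_or_nonempty with rfl | ⟨i₀, _⟩
  · simp
  have hR0 : 0 ≤ R := (norm_nonneg _).trans (hR i₀)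
  have hφ0 : 0 ≤ φ := by rw [hφ]; positivity
  have hφR : φ * R ≤ θ := by
    rw [hφ]; nlinarith
  have hD0 : 0 ≤ D := by linarith
  -- Under the Bernoulli law with mean `p i`, the term linear in `b - p i` averages to zero, its
  -- square to `p i (1 - p i)`, and `b² = b` to `p i`.
  have hstep : ∀ i ∈ S, p i • exp (potentialIncrement S A p Ψ θ φ i 1)
      + (1 - p i) • exp (potentialIncrement S A p Ψ θ φ i 0) ≤
      1 + (8 * θ ^ 2 * D * (p i * (1 - p i))) • (∑ j ∈ S, |Ψ i j| • A j ^ 2)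
        - ((φ - 2 * φ ^ 2 * R ^ 2) * p i) • A i ^ 2 := by
    intro i _
    have hq : 0 ≤ 1 - p i := by linarith [hp1 i]
    have hb : ∀ b : ℝ, |b - p i| ≤ 1 → 0 ≤ b → b ≤ 1 →
        exp (potentialIncrement S A p Ψ θ φ i b) ≤
        1 + potentialIncrement S A p Ψ θ φ i b +
        ((8 * θ ^ 2 * D * (b - p i) ^ 2) • (∑ j ∈ S, |Ψ i j| • A j ^ 2)
        + (2 * φ ^ 2 * R ^ 2 * b ^ 2) • A i ^ 2) := fun b h h0 h1 =>
      (exp_le_one_add_add_sq (potentialIncrement_symm hA i b)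
        (norm_potentialIncrement_le hR hθ hD hφ hθR (hrow i) h h0 h1)).trans
        (add_le_add le_rfl (sq_potentialIncrement_le hA hR hθ hφ0 hφR hD0 (hrow i) b))
    have h1 := smul_mono_of_nonneg (hp0 i) (hb 1
      (abs_le.2 ⟨by linarith, by linarith [hp0 i]⟩) zero_le_one le_rfl)
    have h0 := smul_mono_of_nonneg hq (hb 0
      (abs_le.2 ⟨by linarith [hp1 i], by linarith [hp0 i]⟩) le_rfl zero_le_one)
    refine (add_le_add h1 h0).trans_eq ?_
    simp only [potentialIncrement]
    module
  refine (Finset.sum_le_sum hstep).trans ?_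
  rw [Finset.sum_sub_distrib, Finset.sum_add_distrib, Finset.sum_const, ← Nat.cast_smul_eq_nsmul ℝ,
    sub_le_iff_le_add]
  refine add_le_add le_rfl ?_
  have hA0 : ∀ i, 0 ≤ A i ^ 2 := fun i => sq_nonneg_of_symm (hA i)
  -- Symmetry of the variance-weighted influences turns this column sum into a row sum.
  have hcol : ∀ j, ∑ i ∈ S, p i * (1 - p i) * |Ψ i j| ≤ D * p j := by
    intro j
    have hq : 0 ≤ 1 - p j := by linarith [hp1 j]
    have e : ∀ i, p i * (1 - p i) * |Ψ i j| = p j * (1 - p j) * |Ψ j i| := by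
      intro i
      have h1 : 0 ≤ p i * (1 - p i) := mul_nonneg (hp0 i) (by linarith [hp1 i])
      have h2 : 0 ≤ p j * (1 - p j) := mul_nonneg (hp0 j) hq
      rw [← abs_of_nonneg h1, ← abs_mul, hsymm, abs_mul, abs_of_nonneg h2]
    simp_rw [e]
    rw [← Finset.mul_sum]
    have hrj : p j * (1 - p j) * ∑ i ∈ S, |Ψ j i| ≤ p j * (1 - p j) * D :=
      mul_le_mul_of_nonneg_left (hrow j) (mul_nonneg (hp0 j) hq)
    have : 0 ≤ D * p j * p j := mul_nonneg (mul_nonneg hD0 (hp0 j)) (hp0 j)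
    nlinarith
  simp_rw [Finset.smul_sum, smul_smul]
  rw [Finset.sum_comm]
  refine Finset.sum_le_sum fun j _ => ?_
  rw [← Finset.sum_smul]
  have hc : ∑ i ∈ S, 8 * θ ^ 2 * D * (p i * (1 - p i)) * |Ψ i j|
      ≤ (φ - 2 * φ ^ 2 * R ^ 2) * p j := by
    simp_rw [mul_assoc (8 * θ ^ 2 * D)]
    rw [← Finset.mul_sum]
    refine (mul_le_mul_of_nonneg_left (hcol j) (by positivity)).trans ?_
    -- As `φ R ≤ θ` and `D ≥ 1`, the right side is at least `(16 - 2) θ² D²`.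
    have h1 : 8 * θ ^ 2 * D * D ≤ φ - 2 * φ ^ 2 * R ^ 2 := by
      have h2 : (16 * D ^ 2 * R * θ) ^ 2 ≤ 1 := by
        have : 0 ≤ 16 * D ^ 2 * R * θ := by positivity
        nlinarith
      have h3 : (φ * R) ^ 2 = (θ ^ 2) * (16 * D ^ 2 * R * θ) ^ 2 := by rw [hφ]; ring
      have h4 : θ ^ 2 * (16 * D ^ 2 * R * θ) ^ 2 ≤ θ ^ 2 * D ^ 2 := by
        refine mul_le_mul_of_nonneg_left ?_ (sq_nonneg θ)
        nlinarith
      rw [show 2 * φ ^ 2 * R ^ 2 = 2 * (φ * R) ^ 2 by ring, h3]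
      have : 0 ≤ θ ^ 2 * D ^ 2 := by positivity
      nlinarith
    calc 8 * θ ^ 2 * D * (D * p j) = (8 * θ ^ 2 * D * D) * p j := by ring
      _ ≤ _ := mul_le_mul_of_nonneg_right h1 (hp0 j)
  rw [← sub_nonneg, ← sub_smul]
  simpa using smul_mono_of_nonneg (sub_nonneg.2 hc) (hA0 j)

end RevealStep

/-! ### Conditional means and influences for a weight on the cube. -/

section WeightedCube

variable {n : ℕ}

/-- The weight of a set of points of the cube. -/
def weight (w : (Fin n → Fin 2) → ℝ) (E : Finset (Fin n → Fin 2)) : ℝ := ∑ x ∈ E, w x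

/-- The conditional mean of the `j`-th coordinate on a set of points of the cube. -/
noncomputable def condMean (w : (Fin n → Fin 2) → ℝ) (E : Finset (Fin n → Fin 2)) (j : Fin n) : ℝ :=
  (∑ x ∈ E, w x * ((x j : ℕ) : ℝ)) / weight w E

/-- The points of `E` whose `i`-th coordinate is `b`. -/
def slice (E : Finset (Fin n → Fin 2)) (i : Fin n) (b : Fin 2) : Finset (Fin n → Fin 2) :=
  E.filter fun x => x i = b

/-- The influence of coordinate `i` on coordinate `j` for the weight restricted to `E`. -/
noncomputable def influence (w : (Fin n → Fin 2) → ℝ) (E : Finset (Fin n → Fin 2))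
    (i j : Fin n) : ℝ :=
  open Classical in
  if 0 < weight w (slice E i 1) ∧ 0 < weight w (slice E i 0) then
    condMean w (slice E i 1) j - condMean w (slice E i 0) j
  else 0

/-- The points of the cube agreeing with `y` on `Λ`. -/
def subcube (Λ : Finset (Fin n)) (y : Fin n → Fin 2) : Finset (Fin n → Fin 2) :=
  Finset.univ.filter fun x => ∀ ℓ ∈ Λ, x ℓ = y ℓ

lemma slice_subcube {Λ : Finset (Fin n)} (y : Fin n → Fin 2) {i : Fin n} (hi : i ∉ Λ)
    (b : Fin 2) : slice (subcube Λ y) i b = subcube (insert i Λ) (Function.update y i b) := by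
  ext x
  simp only [slice, subcube, Finset.mem_filter, Finset.mem_univ, true_and, Finset.mem_insert,
    forall_eq_or_imp, Function.update_self]
  rw [and_comm]
  refine and_congr_right fun _ => forall₂_congr fun ℓ hℓ => ?_
  rw [Function.update_of_ne (ne_of_mem_of_not_mem hℓ hi)]

variable {w : (Fin n → Fin 2) → ℝ} {E : Finset (Fin n → Fin 2)}

lemma sum_slice {V : Type*} [AddCommMonoid V] (E : Finset (Fin n → Fin 2)) (i : Fin n)
    (f : (Fin n → Fin 2) → V) :
    ∑ x ∈ E, f x = ∑ x ∈ slice E i 1, f x + ∑ x ∈ slice E i 0, f x := by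
  rw [← Finset.sum_filter_add_sum_filter_not E (fun x => x i = 1)]
  congr 1
  refine Finset.sum_congr ?_ fun _ _ => rfl
  ext x
  simp only [slice, Finset.mem_filter]
  refine and_congr_right fun _ => ?_
  omega

lemma weight_nonneg (hw : ∀ x, 0 ≤ w x) (E : Finset (Fin n → Fin 2)) : 0 ≤ weight w E :=
  Finset.sum_nonneg fun x _ => hw x

lemma weight_slice_add (w : (Fin n → Fin 2) → ℝ) (E : Finset (Fin n → Fin 2)) (i : Fin n) :
    weight w E = weight w (slice E i 1) + weight w (slice E i 0) := sum_slice E i w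

lemma sum_eq_zero_of_weight_eq_zero (hw : ∀ x, 0 ≤ w x) (h : weight w E = 0)
    (f : (Fin n → Fin 2) → ℝ) : ∑ x ∈ E, w x * f x = 0 :=
  Finset.sum_eq_zero fun x hx => by
    rw [(Finset.sum_eq_zero_iff_of_nonneg fun x _ => hw x).1 h x hx, zero_mul]

/-- Multiplied out, the formula survives on null sets, where `condMean` takes the value `0` by
division by zero. -/
lemma weight_mul_condMean (hw : ∀ x, 0 ≤ w x) (E : Finset (Fin n → Fin 2)) (j : Fin n) :
    weight w E * condMean w E j = ∑ x ∈ E, w x * ((x j : ℕ) : ℝ) := by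
  rcases eq_or_ne (weight w E) 0 with h | h
  · rw [h, zero_mul, sum_eq_zero_of_weight_eq_zero hw h]
  · rw [condMean, mul_div_cancel₀ _ h]

lemma sum_slice_mul (E : Finset (Fin n → Fin 2)) (i : Fin n) (b : Fin 2) :
    ∑ x ∈ slice E i b, w x * ((x i : ℕ) : ℝ) = weight w (slice E i b) * ((b : ℕ) : ℝ) := by
  rw [weight, Finset.sum_mul]
  exact Finset.sum_congr rfl fun x hx => by rw [(Finset.mem_filter.1 hx).2]

lemma condMean_slice_self {i : Fin n} {b : Fin 2} (h : weight w (slice E i b) ≠ 0) :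
    condMean w (slice E i b) i = ((b : ℕ) : ℝ) := by
  rw [condMean, sum_slice_mul, mul_div_cancel_left₀ _ h]

lemma weight_mul_condMean_eq_slice (hw : ∀ x, 0 ≤ w x) (E : Finset (Fin n → Fin 2)) (i : Fin n) :
    weight w E * condMean w E i = weight w (slice E i 1) := by
  rw [weight_mul_condMean hw, sum_slice E i, sum_slice_mul, sum_slice_mul]
  simp

lemma weight_mul_one_sub_condMean (hw : ∀ x, 0 ≤ w x) (E : Finset (Fin n → Fin 2)) (i : Fin n) :
    weight w E * (1 - condMean w E i) = weight w (slice E i 0) := by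
  rw [mul_sub, weight_mul_condMean_eq_slice hw, mul_one, weight_slice_add w E i]
  ring

lemma condMean_nonneg (hw : ∀ x, 0 ≤ w x) (E : Finset (Fin n → Fin 2)) (i : Fin n) :
    0 ≤ condMean w E i :=
  div_nonneg (Finset.sum_nonneg fun x _ => mul_nonneg (hw x) (Nat.cast_nonneg _))
    (weight_nonneg hw E)

lemma condMean_le_one (hw : ∀ x, 0 ≤ w x) (E : Finset (Fin n → Fin 2)) (i : Fin n) :
    condMean w E i ≤ 1 := by
  refine div_le_one_of_le₀ (Finset.sum_le_sum fun x _ => ?_) (weight_nonneg hw E)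
  refine mul_le_of_le_one_right (hw x) ?_
  exact_mod_cast Nat.lt_succ_iff.1 (x i).isLt

lemma weight_mul_condMean_slice_add (hw : ∀ x, 0 ≤ w x) (E : Finset (Fin n → Fin 2))
    (i j : Fin n) :
    weight w E * condMean w E j = weight w (slice E i 1) * condMean w (slice E i 1) j
      + weight w (slice E i 0) * condMean w (slice E i 0) j := by
  simp only [weight_mul_condMean hw]
  exact sum_slice E i _

/-- The mean on `E` is the mixture of the two slice means with weights `p_i` and `1 - p_i`. If the
other slice is null, conditioning changes nothing and the influence is `0`. -/
lemma condMean_slice_sub (hw : ∀ x, 0 ≤ w x) {i : Fin n} {b : Fin 2}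
    (h : 0 < weight w (slice E i b)) (j : Fin n) :
    condMean w (slice E i b) j - condMean w E j
      = (((b : ℕ) : ℝ) - condMean w E i) * influence w E i j := by
  have h1 := weight_nonneg hw (slice E i 1)
  have h0 := weight_nonneg hw (slice E i 0)
  have hadd := weight_slice_add w E i
  have hM : 0 < weight w E := by
    fin_cases b
    · simp only [Fin.zero_eta] at h; linarith
    · simp only [Fin.mk_one] at h; linarith
  have e1 := weight_mul_condMean_eq_slice hw E i
  have e2 := weight_mul_condMean_slice_add hw E i j
  refine mul_left_cancel₀ hM.ne' ?_
  rw [influence]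
  split_ifs with hc
  · have e3 : weight w E * (((b : ℕ) : ℝ) - condMean w E i)
        = weight w E * ((b : ℕ) : ℝ) - weight w (slice E i 1) := by rw [mul_sub, e1]
    rw [← mul_assoc, e3, mul_sub, e2, hadd]
    fin_cases b <;> simp <;> ring
  · rw [mul_zero, mul_zero, mul_sub, e2]
    fin_cases b
    · simp only [Fin.zero_eta] at h ⊢
      have : weight w (slice E i 1) = 0 := by
        by_contra hne; exact hc ⟨lt_of_le_of_ne h1 (Ne.symm hne), h⟩
      rw [hadd, this]; ring
    · simp only [Fin.mk_one] at h ⊢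
      have : weight w (slice E i 0) = 0 := by
        by_contra hne; exact hc ⟨h, lt_of_le_of_ne h0 (Ne.symm hne)⟩
      rw [hadd, this]; ring

/-- The right side is the covariance of the two coordinates, which makes the symmetry in `i` and `j`
visible. If a slice is null, both sides vanish. -/
lemma variance_mul_influence (hw : ∀ x, 0 ≤ w x) (hM : 0 < weight w E) (i j : Fin n) :
    condMean w E i * (1 - condMean w E i) * influence w E i j
      = (∑ x ∈ E, w x * (((x i : ℕ) : ℝ) * ((x j : ℕ) : ℝ))) / weight w E
        - condMean w E i * condMean w E j := by
  have e1 := weight_mul_condMean_eq_slice hw E i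
  have e0 := weight_mul_one_sub_condMean hw E i
  have e2 := weight_mul_condMean_slice_add hw E i j
  have hadd := weight_slice_add w E i
  have hN : ∑ x ∈ E, w x * (((x i : ℕ) : ℝ) * ((x j : ℕ) : ℝ))
      = weight w (slice E i 1) * condMean w (slice E i 1) j := by
    rw [weight_mul_condMean hw, sum_slice E i]
    have z : ∑ x ∈ slice E i 0, w x * (((x i : ℕ) : ℝ) * ((x j : ℕ) : ℝ)) = 0 :=
      Finset.sum_eq_zero fun x hx => by rw [(Finset.mem_filter.1 hx).2]; simp
    rw [z, add_zero]
    exact Finset.sum_congr rfl fun x hx => by rw [(Finset.mem_filter.1 hx).2]; simp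
  have h1 := weight_nonneg hw (slice E i 1)
  have h0 := weight_nonneg hw (slice E i 0)
  have hcov : weight w (slice E i 1) * weight w (slice E i 0) * influence w E i j
      = weight w E * (weight w (slice E i 1) * condMean w (slice E i 1) j)
        - weight w (slice E i 1) * (weight w E * condMean w E j) := by
    rw [e2, hadd, influence]
    split_ifs with hc
    · ring
    · rcases h1.eq_or_lt with h | h
      · rw [← h]; ring
      · have : weight w (slice E i 0) = 0 := by
          by_contra hne; exact hc ⟨h, lt_of_le_of_ne h0 (Ne.symm hne)⟩
        rw [this]; ring
  rw [hN]
  refine mul_left_cancel₀ (pow_pos hM 2).ne' ?_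
  calc weight w E ^ 2 * (condMean w E i * (1 - condMean w E i) * influence w E i j)
      = (weight w E * condMean w E i) * (weight w E * (1 - condMean w E i))
        * influence w E i j := by ring
    _ = weight w E * (weight w (slice E i 1) * condMean w (slice E i 1) j)
        - (weight w E * condMean w E i) * (weight w E * condMean w E j) := by
      rw [e1, e0, hcov]
    _ = _ := by
      field_simp

lemma variance_mul_influence_symm (hw : ∀ x, 0 ≤ w x) (hM : 0 < weight w E) (i j : Fin n) :
    condMean w E i * (1 - condMean w E i) * influence w E i j
      = condMean w E j * (1 - condMean w E j) * influence w E j i := by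
  rw [variance_mul_influence hw hM, variance_mul_influence hw hM]
  simp only [mul_comm (condMean w E i), mul_comm ((((_ : Fin n → Fin 2) i : ℕ) : ℝ))]

lemma condMean_subcube {Λ : Finset (Fin n)} {y : Fin n → Fin 2} {j : Fin n} (hj : j ∈ Λ)
    (hM : weight w (subcube Λ y) ≠ 0) : condMean w (subcube Λ y) j = ((y j : ℕ) : ℝ) := by
  rw [condMean, div_eq_iff hM, weight, Finset.mul_sum]
  refine Finset.sum_congr rfl fun x hx => ?_
  rw [(Finset.mem_filter.1 hx).2 j hj, mul_comm]

end WeightedCube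

/-! ### Induction for the trace moment generating function. -/

section TraceMgf

open Matrix NormedSpace
open scoped MatrixOrder

variable {n d : ℕ}

/-- The exponent controlling the trace moment generating function after the coordinates outside
`S` have been revealed. -/
noncomputable def potential (A : Fin n → Matrix (Fin d) (Fin d) ℝ) (θ φ : ℝ)
    (w : (Fin n → Fin 2) → ℝ) (E : Finset (Fin n → Fin 2)) (S : Finset (Fin n)) :
    Matrix (Fin d) (Fin d) ℝ :=
  θ • ∑ j, condMean w E j • A j + φ • ∑ j ∈ S, condMean w E j • A j ^ 2

variable {A : Fin n → Matrix (Fin d) (Fin d) ℝ} {w : (Fin n → Fin 2) → ℝ} {D R θ φ : ℝ}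

lemma potential_symm (hA : ∀ i, (A i)ᵀ = A i) (E : Finset (Fin n → Fin 2)) (S : Finset (Fin n)) :
    (potential A θ φ w E S)ᵀ = potential A θ φ w E S := by
  simp only [potential, transpose_add, transpose_smul, transpose_sum, transpose_pow, hA]

lemma potential_slice (hw : ∀ x, 0 ≤ w x) {Λ : Finset (Fin n)} {y : Fin n → Fin 2} {i : Fin n}
    (hi : i ∉ Λ) {b : Fin 2} (hb : 0 < weight w (slice (subcube Λ y) i b)) :
    potential A θ φ w (slice (subcube Λ y) i b) (insert i Λ)ᶜ
      = potential A θ φ w (subcube Λ y) Λᶜ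
        + potentialIncrement Λᶜ A (condMean w (subcube Λ y)) (influence w (subcube Λ y)) θ φ i
          ((b : ℕ) : ℝ) := by
  have hM : 0 < weight w (subcube Λ y) := by
    refine hb.trans_le (Finset.sum_le_sum_of_subset_of_nonneg (Finset.filter_subset _ _)
      fun x _ _ => hw x)
  have hdiff := condMean_slice_sub (E := subcube Λ y) hw hb
  -- Means of coordinates already revealed do not move, so sums over all `j` reduce to `Λᶜ`.
  have hzero : ∀ j ∈ Λ, (((b : ℕ) : ℝ) - condMean w (subcube Λ y) i)
      * influence w (subcube Λ y) i j = 0 := by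
    intro j hj
    rw [← hdiff j]
    have hs := hb
    rw [slice_subcube y hi] at hs ⊢
    rw [condMean_subcube (Finset.mem_insert_of_mem hj) hs.ne', condMean_subcube hj hM.ne',
      Function.update_of_ne (ne_of_mem_of_not_mem hj hi), sub_self]
  have hS : Λᶜ = insert i (insert i Λ)ᶜ := by
    ext j; by_cases h : j = i <;> simp [h, hi]
  have hiS : i ∉ (insert i Λ)ᶜ := by simp
  have hself := condMean_slice_self (w := w) hb.ne'
  have e : ∀ j, condMean w (slice (subcube Λ y) i b) j = condMean w (subcube Λ y) j
      + (((b : ℕ) : ℝ) - condMean w (subcube Λ y) i) * influence w (subcube Λ y) i j := fun j => by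
    rw [← hdiff j]; ring
  have s1 : ∑ j, condMean w (slice (subcube Λ y) i b) j • A j
      = ∑ j, condMean w (subcube Λ y) j • A j
        + (((b : ℕ) : ℝ) - condMean w (subcube Λ y) i) •
          ∑ j ∈ Λᶜ, influence w (subcube Λ y) i j • A j := by
    have : (((b : ℕ) : ℝ) - condMean w (subcube Λ y) i) •
          ∑ j ∈ Λᶜ, influence w (subcube Λ y) i j • A j
        = ∑ j, ((((b : ℕ) : ℝ) - condMean w (subcube Λ y) i)
          * influence w (subcube Λ y) i j) • A j := by
      rw [Finset.smul_sum, ← Finset.sum_compl_add_sum Λ, Finset.sum_eq_zero (s := Λ), add_zero]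
      · simp_rw [smul_smul]
      · intro j hj; rw [hzero j hj, zero_smul]
    rw [this, ← Finset.sum_add_distrib]
    exact Finset.sum_congr rfl fun j _ => by rw [e j, add_smul]
  have s2 : ∑ j ∈ (insert i Λ)ᶜ, condMean w (slice (subcube Λ y) i b) j • A j ^ 2
      = ∑ j ∈ Λᶜ, condMean w (subcube Λ y) j • A j ^ 2
        + (((b : ℕ) : ℝ) - condMean w (subcube Λ y) i) •
          ∑ j ∈ Λᶜ, influence w (subcube Λ y) i j • A j ^ 2 - ((b : ℕ) : ℝ) • A i ^ 2 := by
    rw [eq_sub_iff_add_eq, Finset.smul_sum, ← Finset.sum_add_distrib]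
    -- Put the term of `i` back into the sum: on the slice its mean is exactly `b`. This is the
    -- source of the drift.
    have : ∑ j ∈ Λᶜ, condMean w (slice (subcube Λ y) i b) j • A j ^ 2
        = ∑ j ∈ (insert i Λ)ᶜ, condMean w (slice (subcube Λ y) i b) j • A j ^ 2
          + ((b : ℕ) : ℝ) • A i ^ 2 := by
      rw [hS, Finset.sum_insert hiS, hself, add_comm]
    rw [← this]
    exact Finset.sum_congr rfl fun j _ => by rw [e j, add_smul, smul_smul]
  rw [potential, potential, potentialIncrement, s1, s2]
  simp_rw [smul_add (influence _ _ _ _), smul_comm (influence _ _ _ _) θ,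
    smul_comm (influence _ _ _ _) φ]
  rw [Finset.sum_add_distrib, ← Finset.smul_sum, ← Finset.smul_sum]
  module

/-- Bound for the trace moment generating function on a subcube. -/
lemma sum_trace_exp_subcube_le (hw : ∀ x, 0 ≤ w x) (hA : ∀ i, (A i)ᵀ = A i)
    (hR : ∀ i, ‖A i‖ ≤ R) (hθ : 0 ≤ θ) (hD : 1 ≤ D) (hφ : φ = 16 * θ ^ 2 * D ^ 2)
    (hθR : 16 * D ^ 2 * R * θ ≤ 1)
    (hrow : ∀ Λ y i, ∑ j, |influence w (subcube Λ y) i j| ≤ D)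
    {H : Matrix (Fin d) (Fin d) ℝ} (hH : Hᵀ = H) (k : ℕ) :
    ∀ (Λ : Finset (Fin n)) (y : Fin n → Fin 2), Λᶜ.card = k →
      ∑ x ∈ subcube Λ y, w x * (exp (H + θ • matrixSum A x)).trace
        ≤ weight w (subcube Λ y) * (exp (H + potential A θ φ w (subcube Λ y) Λᶜ)).trace := by
  induction k with
  | zero =>
    intro Λ y hk
    rw [Finset.card_eq_zero] at hk
    have hΛ : Λ = Finset.univ := by rwa [Finset.compl_eq_empty_iff] at hk
    subst hΛ
    have hs : subcube Finset.univ y = {y} := by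
      ext x; simp [subcube, funext_iff]
    rw [hk, hs]
    have hwt : weight w {y} = w y := by simp [weight]
    rcases eq_or_ne (w y) 0 with h0 | h0
    · simp [hwt, h0]
    · rw [hwt, Finset.sum_singleton, potential, matrixSum, Finset.sum_empty, smul_zero, add_zero]
      have : ∀ j, condMean w {y} j = ((y j : ℕ) : ℝ) := fun j => by
        rw [condMean, hwt, Finset.sum_singleton, mul_div_cancel_left₀ _ h0]
      simp_rw [this]
      exact le_rfl
  | succ k ih =>
    intro Λ y hk
    set E := subcube Λ y with hE
    set G := exp (H + potential A θ φ w E Λᶜ) with hG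
    set f := fun x => w x * (exp (H + θ • matrixSum A x)).trace with hf
    rcases (weight_nonneg hw E).eq_or_lt with h0 | hM
    · rw [← h0, zero_mul, sum_eq_zero_of_weight_eq_zero hw h0.symm]
    have hslice : ∀ i ∈ Λᶜ, ∀ b : Fin 2, ∑ x ∈ slice E i b, f x ≤ weight w (slice E i b) *
        (G * exp (potentialIncrement Λᶜ A (condMean w E) (influence w E) θ φ i
          ((b : ℕ) : ℝ))).trace := by
      intro i hi b
      have hi' : i ∉ Λ := by simpa using hi
      rcases (weight_nonneg hw (slice E i b)).eq_or_lt with h0 | hb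
      · rw [← h0, zero_mul]
        exact (sum_eq_zero_of_weight_eq_zero hw h0.symm _).le
      · have h1 := ih (insert i Λ) (Function.update y i b) (by
          rw [Finset.compl_insert, Finset.card_erase_of_mem hi, hk, Nat.add_sub_cancel])
        rw [← slice_subcube y hi' b, ← hE] at h1
        refine h1.trans (mul_le_mul_of_nonneg_left ?_ hb.le)
        rw [hE, potential_slice hw hi' hb, ← add_assoc]
        -- Golden–Thompson separates the increment, which need not commute with the old potential.
        exact trace_exp_add_le (by rw [transpose_add, hH, potential_symm hA])
          (potentialIncrement_symm hA i _)
    have hstep : ∀ i ∈ Λᶜ, ∑ x ∈ E, f x ≤ weight w E *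
        (G * (condMean w E i • exp (potentialIncrement Λᶜ A (condMean w E) (influence w E) θ φ i 1)
          + (1 - condMean w E i) •
            exp (potentialIncrement Λᶜ A (condMean w E) (influence w E) θ φ i 0))).trace := by
      intro i hi
      rw [sum_slice E i]
      refine (add_le_add (hslice i hi 1) (hslice i hi 0)).trans_eq ?_
      rw [mul_add, trace_add, mul_smul_comm, mul_smul_comm, trace_smul, trace_smul, mul_add,
        smul_eq_mul, smul_eq_mul, ← mul_assoc, ← mul_assoc, weight_mul_condMean_eq_slice hw,
        weight_mul_one_sub_condMean hw]
      simp
    -- The same left side is bounded for every unrevealed `i`; summing these bounds amounts to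
    -- revealing a uniformly random coordinate.
    have hsum := Finset.sum_le_sum hstep
    rw [Finset.sum_const, ← Finset.mul_sum, ← trace_sum, ← Finset.mul_sum, nsmul_eq_mul] at hsum
    have hG0 : 0 ≤ G := exp_nonneg_of_symm (by rw [transpose_add, hH, potential_symm hA])
    have hone := sum_exp_potentialIncrement_le (S := Λᶜ) (p := condMean w E)
      (Ψ := influence w E) hA hR hθ hD hφ hθR (condMean_nonneg hw E) (condMean_le_one hw E)
      (variance_mul_influence_symm hw hM) (fun i =>
        (Finset.sum_le_univ_sum_of_nonneg fun j => abs_nonneg _).trans (hrow Λ y i))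
    have htr := trace_mul_nonneg hG0 (sub_nonneg.2 hone)
    rw [mul_sub, trace_sub, mul_smul_comm, trace_smul, mul_one, smul_eq_mul, sub_nonneg] at htr
    have hcard : (0 : ℝ) < Λᶜ.card := by rw [hk]; positivity
    refine le_of_mul_le_mul_left (hsum.trans ?_) hcard
    refine (mul_le_mul_of_nonneg_left htr hM.le).trans_eq ?_
    ring

end TraceMgf

/-! ### Transfer to measures, degenerate cases, and the Chernoff bound. -/

section Measures

variable {n d : ℕ}

set_option linter.unusedSectionVars false

/-- The weight function of a measure on the cube. -/
noncomputable def pointMass (μ : Measure (Fin n → Fin 2)) (x : Fin n → Fin 2) : ℝ := μ.real {x}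

variable (μ : Measure (Fin n → Fin 2)) [IsProbabilityMeasure μ]

lemma weight_pointMass (E : Finset (Fin n → Fin 2)) : weight (pointMass μ) E = μ.real E :=
  sum_measureReal_singleton E

lemma pointMass_nonneg (x : Fin n → Fin 2) : 0 ≤ pointMass μ x := measureReal_nonneg

lemma weight_pointMass_univ : weight (pointMass μ) Finset.univ = 1 := by
  rw [weight_pointMass, Finset.coe_univ, probReal_univ]

lemma weight_pointMass_pos_iff (E : Finset (Fin n → Fin 2)) :
    0 < weight (pointMass μ) E ↔ 0 < μ (E : Set (Fin n → Fin 2)) := by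
  rw [weight_pointMass, measureReal_def, ENNReal.toReal_pos_iff]
  exact and_iff_left (measure_lt_top μ _)

lemma cond_real_eq_condMean (E : Finset (Fin n → Fin 2)) (j : Fin n) :
    (μ[|(E : Set (Fin n → Fin 2))]).real {x | x j = 1} = condMean (pointMass μ) E j := by
  rw [measureReal_def, cond_apply E.measurableSet, ENNReal.toReal_mul, ENNReal.toReal_inv,
    condMean, weight_pointMass, div_eq_inv_mul, ← measureReal_def, ← measureReal_def]
  congr 1
  have h : (E : Set (Fin n → Fin 2)) ∩ {x | x j = 1} = (slice E j 1 : Finset _) := by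
    ext x; simp [slice]
  rw [h, ← weight_pointMass, sum_slice E j, sum_slice_mul, sum_slice_mul]
  simp

lemma coe_slice_subcube (Λ : Finset (Fin n)) (y : Fin n → Fin 2) (i : Fin n) (b : Fin 2) :
    {x | x i = b} ∩ pinEvent Λ (fun ℓ => y ℓ) = (slice (subcube Λ y) i b : Set (Fin n → Fin 2)) := by
  ext x
  simp [slice, subcube, pinEvent, and_comm]

lemma influenceMatrix_eq_influence (Λ : Finset (Fin n)) (y : Fin n → Fin 2) (i j : Fin n) :
    influenceMatrix μ Λ (fun ℓ => y ℓ) i j = influence (pointMass μ) (subcube Λ y) i j := by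
  rw [influenceMatrix, influence, Matrix.of_apply]
  simp only [coe_slice_subcube, weight_pointMass_pos_iff, cond_real_eq_condMean]

variable {μ}

lemma TwoSidedLinftyIndep.sum_abs_influence_le {D : ℝ} (h : TwoSidedLinftyIndep μ D)
    (Λ : Finset (Fin n)) (y : Fin n → Fin 2) (i : Fin n) :
    ∑ j, |influence (pointMass μ) (subcube Λ y) i j| ≤ D := by
  simp_rw [← influenceMatrix_eq_influence]
  exact (le_ciSup (f := fun i => ∑ j, |influenceMatrix μ Λ (fun ℓ => y ℓ) i j|)
    (Set.finite_range _).bddAbove i).trans (h Λ fun ℓ => y ℓ)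

/-- The mean of the random matrix `∑ i, x_i A_i`. -/
noncomputable def meanMatrix (μ : Measure (Fin n → Fin 2)) (A : Fin n → Matrix (Fin d) (Fin d) ℝ) :
    Matrix (Fin d) (Fin d) ℝ :=
  ∑ j, condMean (pointMass μ) Finset.univ j • A j

lemma integral_matrixSum {Ω : Type*} [MeasurableSpace Ω] {P : Measure Ω} [IsProbabilityMeasure P]
    {X : Ω → Fin n → Fin 2} (hX : Measurable X) (A : Fin n → Matrix (Fin d) (Fin d) ℝ) :
    ∫ ω, matrixSum A (X ω) ∂P = meanMatrix (P.map X) A := by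
  have : IsProbabilityMeasure (P.map X) := Measure.isProbabilityMeasure_map hX.aemeasurable
  rw [← integral_map (f := matrixSum A) hX.aemeasurable
    (StronglyMeasurable.of_discrete.aestronglyMeasurable), integral_fintype .of_finite]
  simp only [matrixSum, meanMatrix, condMean, weight_pointMass_univ, div_one, Finset.smul_sum,
    Finset.sum_smul, smul_smul]
  rw [Finset.sum_comm]
  rfl

lemma deviation_real_eq {Ω : Type*} [MeasurableSpace Ω] {P : Measure Ω} [IsProbabilityMeasure P]
    {X : Ω → Fin n → Fin 2} (hX : Measurable X) (A : Fin n → Matrix (Fin d) (Fin d) ℝ) (t : ℝ) :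
    P.real (deviationEvent P X A t) = ∑ x with t ≤ ‖matrixSum A x - meanMatrix (P.map X) A‖,
      pointMass (P.map X) x := by
  have : IsProbabilityMeasure (P.map X) := Measure.isProbabilityMeasure_map hX.aemeasurable
  change _ = weight _ _
  rw [weight_pointMass, map_measureReal_apply hX (Finset.measurableSet _)]
  congr 1
  ext ω
  simp [deviationEvent, integral_matrixSum hX]

/-! ### Degenerate cases -/

lemma sum_deviation_eq_zero {A : Fin n → Matrix (Fin d) (Fin d) ℝ} {t : ℝ} (ht : 0 < t)
    (h : ∀ x, pointMass μ x ≠ 0 → ∀ i,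
      ((x i : ℕ) : ℝ) • A i = condMean (pointMass μ) Finset.univ i • A i) :
    ∑ x with t ≤ ‖matrixSum A x - meanMatrix μ A‖, pointMass μ x = 0 := by
  refine Finset.sum_eq_zero fun x hx => ?_
  by_contra hne
  have h1 := (Finset.mem_filter.1 hx).2
  have : matrixSum A x = meanMatrix μ A := Finset.sum_congr rfl fun i _ => h x hne i
  rw [this, sub_self, norm_zero] at h1
  exact absurd h1 (not_le.2 ht)

lemma apply_eq_zero_of_condMean_eq_zero {i : Fin n}
    (h : condMean (pointMass μ) Finset.univ i = 0) {x : Fin n → Fin 2} (hx : pointMass μ x ≠ 0) :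
    x i = 0 := by
  have h1 := weight_mul_condMean_eq_slice (pointMass_nonneg μ) Finset.univ i
  rw [h, mul_zero] at h1
  by_contra hne
  exact hx ((Finset.sum_eq_zero_iff_of_nonneg fun x _ => pointMass_nonneg μ x).1 h1.symm x
    (Finset.mem_filter.2 ⟨Finset.mem_univ _, by omega⟩))

lemma apply_eq_one_of_condMean_eq_one {i : Fin n}
    (h : condMean (pointMass μ) Finset.univ i = 1) {x : Fin n → Fin 2} (hx : pointMass μ x ≠ 0) :
    x i = 1 := by
  have h1 := weight_mul_one_sub_condMean (pointMass_nonneg μ) Finset.univ i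
  rw [h, sub_self, mul_zero] at h1
  by_contra hne
  exact hx ((Finset.sum_eq_zero_iff_of_nonneg fun x _ => pointMass_nonneg μ x).1 h1.symm x
    (Finset.mem_filter.2 ⟨Finset.mem_univ _, by omega⟩))

/-- A coordinate taking both values with positive probability has influence `1` on itself, forcing
`D ≥ 1`. -/
lemma apply_eq_condMean_of_indep_lt_one {D : ℝ} (h : TwoSidedLinftyIndep μ D) (hD : D < 1)
    {x : Fin n → Fin 2} (hx : pointMass μ x ≠ 0) (i : Fin n) :
    ((x i : ℕ) : ℝ) = condMean (pointMass μ) Finset.univ i := by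
  have hs : subcube ∅ x = Finset.univ := by ext; simp [subcube]
  have hrow := h.sum_abs_influence_le ∅ x i
  rw [hs] at hrow
  have hii := (Finset.single_le_sum
    (f := fun j => |influence (pointMass μ) Finset.univ i j|) (fun j _ => abs_nonneg _)
    (Finset.mem_univ i)).trans hrow
  have hw := pointMass_nonneg μ
  have hm1 := weight_mul_condMean_eq_slice hw Finset.univ i
  have hm0 := weight_mul_one_sub_condMean hw Finset.univ i
  rw [weight_pointMass_univ, one_mul] at hm1 hm0
  rcases (weight_nonneg hw (slice Finset.univ i 1)).eq_or_lt with h1 | h1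
  · have hp : condMean (pointMass μ) Finset.univ i = 0 := by rw [hm1, h1]
    rw [hp, apply_eq_zero_of_condMean_eq_zero hp hx]; simp
  · rcases (weight_nonneg hw (slice Finset.univ i 0)).eq_or_lt with h0 | h0
    · have hp : condMean (pointMass μ) Finset.univ i = 1 := by linarith
      rw [hp, apply_eq_one_of_condMean_eq_one hp hx]; simp
    · simp only [influence, h1, h0, and_self, if_true, condMean_slice_self h1.ne',
        condMean_slice_self h0.ne'] at hii
      norm_num at hii
      linarith

/-- Taking traces gives a vanishing sum of nonnegative numbers, and `tr (A i)² = 0` forces `A i =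
0`. -/
lemma condMean_eq_zero_or_eq_zero {A : Fin n → Matrix (Fin d) (Fin d) ℝ}
    (hA : ∀ i, (A i).transpose = A i) (h : meanMatrix μ (fun i => A i ^ 2) = 0) (i : Fin n) :
    condMean (pointMass μ) Finset.univ i = 0 ∨ A i = 0 := by
  have hsq : ∀ j, A j ^ 2 = (A j).conjTranspose * A j := fun j => by
    rw [Matrix.conjTranspose_eq_transpose_of_trivial, hA, pow_two]
  have htr : ∑ j, condMean (pointMass μ) Finset.univ j * (A j ^ 2).trace = 0 := by
    have := congrArg Matrix.trace h
    simpa [meanMatrix, Matrix.trace_sum] using this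
  have hi := (Finset.sum_eq_zero_iff_of_nonneg fun j _ =>
    mul_nonneg (condMean_nonneg (pointMass_nonneg μ) Finset.univ j) (by
      rw [hsq]; exact (Matrix.posSemidef_conjTranspose_mul_self _).trace_nonneg)).1 htr i
    (Finset.mem_univ i)
  refine (mul_eq_zero.1 hi).imp_right fun h0 => ?_
  rw [hsq] at h0
  exact Matrix.trace_conjTranspose_mul_self_eq_zero_iff.1 h0

/-! ### The nondegenerate case -/

lemma meanMatrix_symm {A : Fin n → Matrix (Fin d) (Fin d) ℝ} (hA : ∀ i, (A i).transpose = A i) :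
    (meanMatrix μ A).transpose = meanMatrix μ A := by
  simp only [meanMatrix, Matrix.transpose_sum, Matrix.transpose_smul, hA]

lemma matrixSum_symm {A : Fin n → Matrix (Fin d) (Fin d) ℝ} (hA : ∀ i, (A i).transpose = A i)
    (x : Fin n → Fin 2) : (matrixSum A x).transpose = matrixSum A x := by
  simp only [matrixSum, Matrix.transpose_sum, Matrix.transpose_smul, hA]

/-- Bernstein-type bound for the centred trace moment generating function. -/
lemma sum_trace_exp_centred_le {A : Fin n → Matrix (Fin d) (Fin d) ℝ} {D R θ : ℝ}
    (h : TwoSidedLinftyIndep μ D) (hA : ∀ i, (A i).transpose = A i) (hR : ∀ i, ‖A i‖ ≤ R)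
    (hθ : 0 ≤ θ) (hD : 1 ≤ D) (hθR : 16 * D ^ 2 * R * θ ≤ 1) :
    ∑ x, pointMass μ x * (NormedSpace.exp (θ • (matrixSum A x - meanMatrix μ A))).trace
      ≤ d * Real.exp (16 * θ ^ 2 * D ^ 2 * ‖meanMatrix μ fun i => A i ^ 2‖) := by
  have hV := meanMatrix_symm (μ := μ) (A := fun i => A i ^ 2)
    fun i => by rw [Matrix.transpose_pow, hA]
  -- This `H` centres the sum and cancels the linear part of the initial potential, leaving only the
  -- variance term.
  have hmain := sum_trace_exp_subcube_le (φ := 16 * θ ^ 2 * D ^ 2) (pointMass_nonneg μ) hA hR hθ hD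
    rfl hθR h.sum_abs_influence_le (H := -(θ • meanMatrix μ A))
    (by rw [Matrix.transpose_neg, Matrix.transpose_smul, meanMatrix_symm hA]) _ ∅ 0 rfl
  have hs : subcube ∅ (0 : Fin n → Fin 2) = Finset.univ := by ext; simp [subcube]
  have hpot : -(θ • meanMatrix μ A) + potential A θ (16 * θ ^ 2 * D ^ 2) (pointMass μ)
      Finset.univ Finset.univ = (16 * θ ^ 2 * D ^ 2) • meanMatrix μ fun i => A i ^ 2 := by
    rw [potential, meanMatrix, meanMatrix, neg_add_cancel_left]
  rw [hs, Finset.compl_empty, hpot, weight_pointMass_univ, one_mul] at hmain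
  have e : ∀ x, θ • (matrixSum A x - meanMatrix μ A)
      = -(θ • meanMatrix μ A) + θ • matrixSum A x := fun x => by rw [smul_sub]; abel
  simp_rw [e]
  refine hmain.trans ((trace_exp_le (by rw [Matrix.transpose_smul, hV])).trans_eq ?_)
  rw [Fintype.card_fin, norm_smul, Real.norm_of_nonneg (by positivity)]

lemma sum_deviation_le {A : Fin n → Matrix (Fin d) (Fin d) ℝ} {D R θ t : ℝ}
    (h : TwoSidedLinftyIndep μ D) (hA : ∀ i, (A i).transpose = A i) (hR : ∀ i, ‖A i‖ ≤ R)
    (hθ : 0 ≤ θ) (hD : 1 ≤ D) (hθR : 16 * D ^ 2 * R * θ ≤ 1) (ht : 0 < t) :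
    ∑ x with t ≤ ‖matrixSum A x - meanMatrix μ A‖, pointMass μ x
      ≤ 2 * d * Real.exp
        (16 * θ ^ 2 * D ^ 2 * ‖meanMatrix μ fun i => A i ^ 2‖ - θ * t) := by
  have h1 := sum_trace_exp_centred_le h hA hR hθ hD hθR
  have h2 := sum_trace_exp_centred_le (A := fun i => -A i) h (fun i => by simp [hA])
    (fun i => by simpa using hR i) hθ hD hθR
  have e : ∀ x, matrixSum (fun i => -A i) x - meanMatrix μ (fun i => -A i)
      = -(matrixSum A x - meanMatrix μ A) := fun x => by
    simp only [matrixSum, meanMatrix, smul_neg, Finset.sum_neg_distrib]; abel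
  simp_rw [e, neg_sq] at h2
  have hY : ∀ x, (matrixSum A x - meanMatrix μ A).transpose = matrixSum A x - meanMatrix μ A :=
    fun x => by rw [Matrix.transpose_sub, matrixSum_symm hA, meanMatrix_symm hA]
  have hpos : ∀ (c : ℝ) x, 0 ≤
      (NormedSpace.exp (θ • (c • (matrixSum A x - meanMatrix μ A)))).trace := fun c x => by
    open scoped MatrixOrder in
    exact (Matrix.nonneg_iff_posSemidef.1
      (exp_nonneg_of_symm (by simp only [Matrix.transpose_smul, hY]))).trace_nonneg
  have hkey : (∑ x with t ≤ ‖matrixSum A x - meanMatrix μ A‖, pointMass μ x) * Real.exp (θ * t)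
      ≤ 2 * d * Real.exp (16 * θ ^ 2 * D ^ 2 * ‖meanMatrix μ fun i => A i ^ 2‖) := by
    rw [Finset.sum_mul]
    calc _ ≤ ∑ x with t ≤ ‖matrixSum A x - meanMatrix μ A‖, pointMass μ x *
          ((NormedSpace.exp (θ • (matrixSum A x - meanMatrix μ A))).trace
            + (NormedSpace.exp (θ • -(matrixSum A x - meanMatrix μ A))).trace) :=
          Finset.sum_le_sum fun x hx => mul_le_mul_of_nonneg_left
            (exp_le_trace_exp_add (hY x) ht hθ (Finset.mem_filter.1 hx).2) (pointMass_nonneg μ x)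
      _ ≤ ∑ x, pointMass μ x *
          ((NormedSpace.exp (θ • (matrixSum A x - meanMatrix μ A))).trace
            + (NormedSpace.exp (θ • -(matrixSum A x - meanMatrix μ A))).trace) :=
          Finset.sum_le_sum_of_subset_of_nonneg (Finset.filter_subset _ _) fun x _ _ =>
            mul_nonneg (pointMass_nonneg μ x) (add_nonneg (by simpa using hpos 1 x)
              (by simpa using hpos (-1) x))
      _ ≤ _ := by
          simp_rw [mul_add]
          rw [Finset.sum_add_distrib]
          linarith
  rw [Real.exp_sub, ← mul_div_assoc, le_div_iff₀ (Real.exp_pos _)]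
  exact hkey

/-- The optimized exponent in the Chernoff bound. -/
lemma exists_chernoff_parameter {D s R t : ℝ} (hD : 1 ≤ D) (hs : 0 < s) (hR : 0 < R) (ht : 0 < t) :
    ∃ θ, 0 ≤ θ ∧ 16 * D ^ 2 * R * θ ≤ 1 ∧ 16 * θ ^ 2 * D ^ 2 * s - θ * t
      ≤ -(1 / (64 * D ^ 2)) * min (t ^ 2 / s) (t / R) := by
  have hD0 : 0 < D := by linarith
  -- The unconstrained minimizer of the quadratic exponent, capped by the constraint on `θ`. The
  -- exponent is then at most `-θ t / 2`; the uncapped case dictates the constant `64`.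
  refine ⟨min (t / (32 * D ^ 2 * s)) (1 / (16 * D ^ 2 * R)), by positivity, ?_, ?_⟩
  · calc _ ≤ 16 * D ^ 2 * R * (1 / (16 * D ^ 2 * R)) :=
        mul_le_mul_of_nonneg_left (min_le_right _ _) (by positivity)
      _ = 1 := mul_one_div_cancel (by positivity)
  · set θ := min (t / (32 * D ^ 2 * s)) (1 / (16 * D ^ 2 * R)) with hθ
    have hθ0 : 0 ≤ θ := by positivity
    have h1 : θ * (32 * D ^ 2 * s) ≤ t :=
      (le_div_iff₀ (by positivity)).1 (min_le_left _ _)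
    have h2 : 1 / (64 * D ^ 2) * min (t ^ 2 / s) (t / R) ≤ θ * t / 2 := by
      have hc : 0 ≤ 1 / (64 * D ^ 2) := by positivity
      rcases min_choice (t / (32 * D ^ 2 * s)) (1 / (16 * D ^ 2 * R)) with h | h
      · refine (mul_le_mul_of_nonneg_left (min_le_left _ _) hc).trans_eq ?_
        rw [hθ, h]
        field_simp
        norm_num
      · refine (mul_le_mul_of_nonneg_left (min_le_right _ _) hc).trans ?_
        rw [hθ, h]
        field_simp
        norm_num
    nlinarith

end Measures

/-- The second conjunct covers the cases where the exponent has a vanishing denominator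
(where `a / 0 = ∞` is meant, so that the bound by the first conjunct would be too weak). -/
theorem corollary3p5 :
    ∃ C : ℝ, 0 < C ∧
      ∀ (n d : ℕ) (Ω : Type*) [MeasurableSpace Ω] (P : Measure Ω) [IsProbabilityMeasure P]
        (X : Ω → Fin n → Fin 2) (_ : Measurable X)
        (A : Fin n → Matrix (Fin d) (Fin d) ℝ) (_ : ∀ i, (A i).IsSymm)
        (D : ℝ) (_ : TwoSidedLinftyIndep (P.map X) D) (t : ℝ) (_ : 0 < t),
        P.real (deviationEvent P X A t) ≤
            2 * d * Real.exp (-(1 / (C * D ^ 2)) *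
              min (t ^ 2 / varianceProxy P X A) (t / maxNorm A)) ∧
          (D = 0 ∨ varianceProxy P X A = 0 ∨ maxNorm A = 0 →
            P.real (deviationEvent P X A t) = 0) := by
  refine ⟨64, by norm_num, ?_⟩
  intro n d Ω _ P _ X hX A hA D hD t ht
  have : IsProbabilityMeasure (P.map X) := Measure.isProbabilityMeasure_map hX.aemeasurable
  have hR : ∀ i, ‖A i‖ ≤ maxNorm A := fun i =>
    le_ciSup (f := fun i => ‖A i‖) (Set.finite_range _).bddAbove i
  have hV : varianceProxy P X A = ‖meanMatrix (P.map X) fun i => A i ^ 2‖ := by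
    rw [varianceProxy, integral_matrixSum hX]
  -- Widening `D = 0` to `D < 1` leaves `D ≥ 1` for the main case.
  have hzero : D < 1 ∨ varianceProxy P X A = 0 ∨ maxNorm A = 0 →
      P.real (deviationEvent P X A t) = 0 := by
    intro hdeg
    rw [deviation_real_eq hX]
    refine sum_deviation_eq_zero ht fun x hx i => ?_
    rcases hdeg with h | h | h
    · rw [apply_eq_condMean_of_indep_lt_one hD h hx]
    · rw [hV, norm_eq_zero] at h
      rcases condMean_eq_zero_or_eq_zero hA h i with h0 | h0
      · rw [h0, apply_eq_zero_of_condMean_eq_zero h0 hx]; simp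
      · rw [h0, smul_zero, smul_zero]
    · have h0 : A i = 0 := norm_le_zero_iff.1 (h ▸ hR i)
      rw [h0, smul_zero, smul_zero]
  refine ⟨?_, fun h => hzero (h.imp_left fun h0 : D = 0 => h0 ▸ zero_lt_one)⟩
  by_cases hdeg : D < 1 ∨ varianceProxy P X A = 0 ∨ maxNorm A = 0
  · rw [hzero hdeg]; positivity
  push Not at hdeg
  obtain ⟨hD1, hs, hR0⟩ := hdeg
  have hs' : 0 < varianceProxy P X A := lt_of_le_of_ne (norm_nonneg _) hs.symm
  have hR' : 0 < maxNorm A := lt_of_le_of_ne (Real.iSup_nonneg fun i => norm_nonneg _) hR0.symm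
  obtain ⟨θ, hθ, hθR, hle⟩ := exists_chernoff_parameter hD1 hs' hR' ht
  rw [deviation_real_eq hX]
  refine (sum_deviation_le hD hA hR hθ hD1 hθR ht).trans ?_
  rw [← hV]
  gcongr
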